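/- **Lemma 3.5.** Let $(W,S)$ be a Coxeter system (of arbitrary, possibly infinite, rank), and let $(\Delta,\delta)$ be a building of type $(W,S)$: a set $\Delta$ of chambers in which every $s\in S$ determines an equivalence relation, called $s$-adjacency, whose classes (the panels of type $s$) each contain at least two chambers, together with a map $\delta:\Delta\times\Delta\to W$ such that for every reduced word $f$ over $S$ and all $x,y\in\Delta$ one has $\delta(x,y)=f$ in $W$ if and only if $x$ and $y$ can be joined by a gallery of type $f$. (A gallery of type $s_1\cdots s_k$ is a sequence of chambers $c_0,\dots,c_k$ with $c_{j-1}\ne c_j$ and $c_{j-1}$ $s_j$-adjacent to $c_j$ for all $j$.) View $W$ itself as a building with $w$ and $ws$ $s$-adjacent for $w\in W$, $s\in S$, and with $\delta_W(x,y)=x^{-1}y$. For $X\subseteq W$, an isometry $\alpha:X\to\Delta$ is a map with $\delta(\alpha(x),\alpha(y))=\delta_W(x,y)$ for all $x,y\in X$. An apartment of $\Delta$ is the image of an isometry $W\to\Delta$. For a reflection $r\in W$ (a conjugate of an element of $S$), the wall of $r$ in $W$ is the set of pairs $M_r=\{\{c_1,c_2\}: c_1,c_2\in W \text{ adjacent},\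 rc_1=c_2\}$. A wall in an apartment $\Sigma$ is a set $\Omega=\{\alpha(P):P\in M_r\}$, where $r$ is a reflection and $\alpha$ is an isometry from the set of chambers $\bigcup M_r\subseteq W$ to $\Delta$ with image contained in $\Sigma$; the elements of $\Omega$ are called the panels of $\Omega$. A panel of $\Omega$ is branching if the panel of $\Delta$ containing it has at least three chambers. Let $\Omega$ be a wall in an apartment $\Sigma$ of $\Delta$. If some panel of $\Omega$ is branching, then every panel of $\Omega$ is branching. -/

import Mathlib

/-- A chamber system with set of chambers `C` and index set `I`: every `i : I` determines a
partition of `C`, given here as an equivalence relation, called `i`-adjacency. -/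
structure ChamberSystem (I C : Type*) where
  /-- the equivalence relation of `i`-adjacency -/
  adj : I → Setoid C

namespace ChamberSystem

variable {I C : Type*} (X : ChamberSystem I C)

/-- Two chambers are adjacent if they are `i`-adjacent for some index `i`. -/
def Adjacent (x y : C) : Prop := ∃ i, X.adj i x y

/-- `X.Gallery x f y`: there is a gallery `(c₀, …, c_k)` of type `f = i₁ ⋯ i_k` from `x = c₀` to
`y = c_k`, that is, `c_{j-1}` and `c_j` are distinct and `i_j`-adjacent for all `j`. -/
inductive Gallery : C → List I → C → Prop
  | nil (x : C) : Gallery x [] x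
  | cons {x y z : C} {i : I} {f : List I} (hadj : X.adj i x y) (hne : x ≠ y)
      (h : Gallery y f z) : Gallery x (i :: f) z

/-- The `J`-residue of a chamber `c`: the set of all chambers that can be joined to `c` by a
`J`-gallery. -/
def residue (J : Set I) (c : C) : Set C := {x | ∃ f : List I, (∀ i ∈ f, i ∈ J) ∧ X.Gallery c f x}

/-- A panel (of type `i`) is an `{i}`-residue. -/
def IsPanel (σ : Set C) : Prop := ∃ (i : I) (c : C), σ = X.residue {i} c

/-- The `{i}`-residue of `c` is the part containing `c` of the partition determined by `i`. -/
theorem mem_residue_singleton {i : I} {c x : C} : x ∈ X.residue {i} c ↔ X.adj i c x := by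
  constructor
  · rintro ⟨f, hf, hg⟩
    induction hg with
    | nil x => exact (X.adj i).refl x
    | @cons a b d j g hadj hne h ih =>
      have hj : j = i := hf j (by simp)
      subst hj
      exact (X.adj j).trans hadj (ih fun k hk => hf k (by simp [hk]))
  · intro h
    by_cases hcx : c = x
    · subst hcx
      exact ⟨[], by simp, Gallery.nil c⟩
    · exact ⟨[i], by simp, Gallery.cons h hcx (Gallery.nil x)⟩

end ChamberSystem

/-- A building of type `(W, S)`, where the Coxeter system `(W, S)` is given by `cs` and `S` indexes
the Coxeter generators: a chamber system over `S` in which each panel contains at least two chambers,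
together with a `W`-metric `δ`. A word `f` over `S` is geodesic if and only if it is reduced. -/
structure Building {S W : Type*} [Group W] {M : CoxeterMatrix S} (cs : CoxeterSystem M W)
    (Δ : Type*) extends ChamberSystem S Δ where
  /-- each panel contains at least two chambers -/
  two_le_panel : ∀ σ, toChamberSystem.IsPanel σ → 2 ≤ σ.encard
  /-- the `W`-metric -/
  δ : Δ → Δ → W
  /-- the defining property of the `W`-metric -/
  δ_eq_iff : ∀ f : List S, cs.IsReduced f → ∀ x y : Δ,
    δ x y = cs.wordProd f ↔ toChamberSystem.Gallery x f y

namespace CoxeterSystem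

variable {S W : Type*} [Group W] {M : CoxeterMatrix S} (cs : CoxeterSystem M W)

/-- The chamber system over `S` of a Coxeter system: the chambers are the elements of `W`, and
the part of the partition determined by `s` containing `w` is `{w, ws}`. -/
def chamberSystem : ChamberSystem S W where
  adj i :=
    { r := fun w₁ w₂ => w₂ = w₁ ∨ w₂ = w₁ * cs.simple i
      iseqv :=
        { refl := fun _ => Or.inl rfl
          symm := by
            rintro x y (h | h)
            · exact Or.inl h.symm
            · exact Or.inr (by simp [h])
          trans := by
            rintro x y z (h | h) (h' | h') <;> simp [h, h'] } }

theorem chamberSystem_adj {i : S} {x y : W} :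
    cs.chamberSystem.adj i x y ↔ y = x ∨ y = x * cs.simple i := Iff.rfl

theorem self_ne_mul_simple (i : S) (x : W) : x ≠ x * cs.simple i := by
  intro h
  exact cs.length_mul_simple_ne x i (congrArg cs.length h.symm)

theorem chamberSystem_gallery_iff {f : List S} {x y : W} :
    cs.chamberSystem.Gallery x f y ↔ y = x * cs.wordProd f := by
  constructor
  · intro h
    induction h with
    | nil x => simp
    | cons hadj hne _ ih =>
      rcases hadj with h | h
      · exact absurd h.symm hne
      · rw [ih, h, cs.wordProd_cons, mul_assoc]
  · induction f generalizing x with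
    | nil => rintro rfl; simpa using ChamberSystem.Gallery.nil x
    | cons i f ih =>
      intro h
      exact ChamberSystem.Gallery.cons (Or.inr rfl) (cs.self_ne_mul_simple i x)
        (ih (by rw [h, cs.wordProd_cons, mul_assoc]))

/-- The Coxeter group `W`, viewed as a building of type `(W, S)` with `W`-metric
`δ_W(x, y) = x⁻¹ y`. -/
def building : Building cs W where
  toChamberSystem := cs.chamberSystem
  two_le_panel := by
    rintro σ ⟨i, c, rfl⟩
    have hsub : {c, c * cs.simple i} ⊆ cs.chamberSystem.residue {i} c := by
      rintro x (rfl | rfl)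
      · exact cs.chamberSystem.mem_residue_singleton.2 (Or.inl rfl)
      · exact cs.chamberSystem.mem_residue_singleton.2 (Or.inr rfl)
    rw [← Set.encard_pair (cs.self_ne_mul_simple i c)]
    exact Set.encard_le_encard hsub
  δ x y := x⁻¹ * y
  δ_eq_iff f _ x y := by
    rw [cs.chamberSystem_gallery_iff, inv_mul_eq_iff_eq_mul]

/-- The wall `M_r = {{c₁, c₂} : c₁, c₂ ∈ W are adjacent and r c₁ = c₂}` of a reflection `r` of `W`,
as a set of panels of `W`. -/
def wall (r : W) : Set (Set W) :=
  {P | ∃ c₁ c₂ : W, cs.building.Adjacent c₁ c₂ ∧ r * c₁ = c₂ ∧ P = {c₁, c₂}}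

end CoxeterSystem

namespace Building

variable {S W Δ : Type*} [Group W] {M : CoxeterMatrix S} {cs : CoxeterSystem M W}
  (D : Building cs Δ)

/-- The map `α`, restricted to the subset `X` of `W`, is an isometry `X → Δ`: it preserves the
`W`-distance. The values of `α` outside `X` are irrelevant. -/
def IsIsometryOn (X : Set W) (α : W → Δ) : Prop :=
  ∀ x ∈ X, ∀ y ∈ X, D.δ (α x) (α y) = cs.building.δ x y

/-- An apartment is the image of an isometry `W → Δ`. -/
def IsApartment (A : Set Δ) : Prop :=
  ∃ α : W → Δ, D.IsIsometryOn Set.univ α ∧ A = α '' Set.univ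

/-- `Ω`, a set of panels of `A`, is a wall in the apartment `A`: it is the image of a wall `M_r` of
`W` (`r` a reflection) under an isometry to `A` from the set of chambers contained in the panels
of `M_r`. -/
def IsWallIn (A : Set Δ) (Ω : Set (Set Δ)) : Prop :=
  ∃ r : W, cs.IsReflection r ∧ ∃ α : W → Δ, D.IsIsometryOn (⋃₀ cs.wall r) α ∧
    α '' (⋃₀ cs.wall r) ⊆ A ∧ Ω = (fun P : Set W => α '' P) '' cs.wall r

/-- A panel `P` of an apartment is branching if the panel of the building that contains it is
branching, that is, has degree (number of chambers, possibly infinite) at least 3. -/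
def IsBranching (P : Set Δ) : Prop :=
  ∃ σ : Set Δ, D.IsPanel σ ∧ P ⊆ σ ∧ 3 ≤ σ.encard

end Building

namespace ChamberSystem

variable {I C : Type*} {X : ChamberSystem I C}

/-! Two panels `{c, cs}` and `{d, dt}` of the wall of `r` satisfy `r = c s c⁻¹ = d t d⁻¹`, so `w =
c⁻¹ d` satisfies `sw = wt`; exchanging `c` and `cs` replaces `w` by `sw`, so `sw` may be taken
longer than `w`. A third chamber `e` in the panel of `α c` then has distance `sw = wt` from both `α
d` and `α (dt)`. A geodesic of type `wt` from `e` to `α d` enters the target panel at a chamber at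
distance `w` from `e`, hence different from both: this is the required third chamber
(`IsBranching.of_parallel`). -/

theorem gallery_singleton_iff {i : I} {x y : C} :
    X.Gallery x [i] y ↔ X.adj i x y ∧ x ≠ y := by
  constructor
  · rintro (_ | ⟨hadj, hne, h⟩)
    cases h
    exact ⟨hadj, hne⟩
  · rintro ⟨hadj, hne⟩
    exact .cons hadj hne (.nil y)

theorem Gallery.exists_of_append {f g : List I} {x z : C} (h : X.Gallery x (f ++ g) z) :
    ∃ y, X.Gallery x f y ∧ X.Gallery y g z := by
  induction f generalizing x with
  | nil => exact ⟨x, .nil x, h⟩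
  | cons i f ih =>
    rcases h with _ | ⟨hadj, hne, h⟩
    obtain ⟨y, h₁, h₂⟩ := ih h
    exact ⟨y, .cons hadj hne h₁, h₂⟩

end ChamberSystem

namespace CoxeterSystem

variable {S W : Type*} [Group W] {M : CoxeterMatrix S} (cs : CoxeterSystem M W)

/-- A panel of the wall of a reflection `r` is `{c, cs}` with `r = c s c⁻¹`. -/
theorem exists_simple_of_mem_wall {r : W} (hr : cs.IsReflection r) {P : Set W}
    (hP : P ∈ cs.wall r) :
    ∃ (c : W) (s : S), r * c = c * cs.simple s ∧ P = {c, c * cs.simple s} := by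
  obtain ⟨c₁, c₂, ⟨s, h | h⟩, hrc, rfl⟩ := hP
  -- Adjacency allows equal chambers; that would force `r = 1`, whose length is not odd.
  · obtain rfl := mul_eq_right.1 (hrc.trans h)
    exact absurd hr.odd_length (by simp)
  · exact ⟨c₁, s, hrc.trans h, by rw [h]⟩

end CoxeterSystem

namespace Building

variable {S W Δ : Type*} [Group W] {M : CoxeterMatrix S} {cs : CoxeterSystem M W}
  (D : Building cs Δ)

/-- One-letter words are reduced, so adjacency of distinct chambers can be handled through `δ`
alone. -/
theorem δ_eq_simple_iff {s : S} {x y : Δ} :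
    D.δ x y = cs.simple s ↔ D.adj s x y ∧ x ≠ y := by
  rw [← cs.wordProd_singleton, D.δ_eq_iff [s] (by simp [CoxeterSystem.IsReduced]),
    ChamberSystem.gallery_singleton_iff]

/-- Prepending an adjacent chamber to a geodesic when the length goes up. -/
theorem δ_eq_simple_mul {s : S} {w : W} {x y z : Δ} (hlen : ¬ cs.IsLeftDescent w s)
    (hxy : D.δ x y = cs.simple s) (hyz : D.δ y z = w) : D.δ x z = cs.simple s * w := by
  obtain ⟨f, hf, rfl⟩ := cs.exists_isReduced w
  obtain ⟨hadj, hne⟩ := D.δ_eq_simple_iff.1 hxy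
  have hred : cs.IsReduced (s :: f) := by
    rw [CoxeterSystem.IsReduced, cs.wordProd_cons, cs.not_isLeftDescent_iff.1 hlen, hf,
      List.length_cons]
  rw [← cs.wordProd_cons, D.δ_eq_iff _ hred]
  exact .cons hadj hne ((D.δ_eq_iff f hf y z).1 hyz)

/-- A geodesic of type `wt` passes through a chamber at distance `w` from its origin. -/
theorem exists_δ_eq_of_δ_eq_mul_simple {t : S} {w : W} {x z : Δ}
    (hlen : ¬ cs.IsRightDescent w t) (hxz : D.δ x z = w * cs.simple t) :
    ∃ y, D.δ x y = w ∧ D.δ y z = cs.simple t := by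
  obtain ⟨f, hf, rfl⟩ := cs.exists_isReduced w
  have hred : cs.IsReduced (f ++ [t]) := by
    rw [CoxeterSystem.IsReduced, cs.wordProd_append, cs.wordProd_singleton,
      cs.not_isRightDescent_iff.1 hlen, hf, List.length_append, List.length_singleton]
  rw [← cs.wordProd_singleton, ← cs.wordProd_append, D.δ_eq_iff _ hred] at hxz
  obtain ⟨y, h₁, h₂⟩ := hxz.exists_of_append
  exact ⟨y, (D.δ_eq_iff f hf x y).2 h₁,
    D.δ_eq_simple_iff.2 (ChamberSystem.gallery_singleton_iff.1 h₂)⟩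

/-- A pair of `s`-adjacent chambers is branching if and only if some third chamber is `s`-adjacent
to both. -/
theorem isBranching_pair_iff {s : S} {x x' : Δ} (h : D.δ x x' = cs.simple s) :
    D.IsBranching {x, x'} ↔ ∃ e, D.δ e x = cs.simple s ∧ D.δ e x' = cs.simple s := by
  obtain ⟨hadj, hne⟩ := D.δ_eq_simple_iff.1 h
  constructor
  · rintro ⟨σ, ⟨i, c, rfl⟩, hsub, hcard⟩
    have hcx := D.mem_residue_singleton.1 (hsub (Set.mem_insert x {x'}))
    have hcx' := D.mem_residue_singleton.1 (hsub (Set.mem_insert_of_mem x rfl))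
    -- The panel may come with another index `i`; both generators equal `δ x x'`, and equality in
    -- `W` is all that is needed.
    have his : cs.simple s = cs.simple i :=
      h.symm.trans (D.δ_eq_simple_iff.2 ⟨(D.adj i).trans ((D.adj i).symm hcx) hcx', hne⟩)
    have hnot : ¬ D.residue {i} c ⊆ {x, x'} := fun hle => by
      have := hcard.trans ((Set.encard_le_encard hle).trans (Set.encard_pair hne).le)
      exact absurd this (by norm_num)
    obtain ⟨e, he, hex⟩ := Set.not_subset.1 hnot
    simp only [Set.mem_insert_iff, Set.mem_singleton_iff, not_or] at hex
    have hec := (D.adj i).symm (D.mem_residue_singleton.1 he)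
    rw [his]
    exact ⟨e, D.δ_eq_simple_iff.2 ⟨(D.adj i).trans hec hcx, hex.1⟩,
      D.δ_eq_simple_iff.2 ⟨(D.adj i).trans hec hcx', hex.2⟩⟩
  · rintro ⟨e, hex, hex'⟩
    obtain ⟨hadje, hnex⟩ := D.δ_eq_simple_iff.1 hex
    have hnex' := (D.δ_eq_simple_iff.1 hex').2
    have hx : x ∈ D.residue {s} x := D.mem_residue_singleton.2 ((D.adj s).refl x)
    have hx' : x' ∈ D.residue {s} x := D.mem_residue_singleton.2 hadj
    have he : e ∈ D.residue {s} x := D.mem_residue_singleton.2 ((D.adj s).symm hadje)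
    refine ⟨D.residue {s} x, ⟨s, x, rfl⟩, Set.insert_subset hx (Set.singleton_subset_iff.2 hx'), ?_⟩
    rw [← Set.encard_eq_three.2 ⟨e, x, x', hnex, hnex', hne, rfl⟩]
    exact Set.encard_le_encard
      (Set.insert_subset he (Set.insert_subset hx (Set.singleton_subset_iff.2 hx')))

/-- Branching passes between opposite panels: if `sw = wt` is longer than `w`, and the panels
`{x, x'}` of type `s` and `{y, y'}` of type `t` satisfy `δ x y = δ x' y' = w`, then the first being
branching implies that the second is. -/
theorem IsBranching.of_parallel {s t : S} {w : W} {x x' y y' : Δ}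
    (hw : cs.simple s * w = w * cs.simple t) (hlen : ¬ cs.IsLeftDescent w s)
    (hx : D.δ x x' = cs.simple s) (hy : D.δ y y' = cs.simple t)
    (hxy : D.δ x y = w) (hxy' : D.δ x' y' = w) (hb : D.IsBranching {x, x'}) :
    D.IsBranching {y, y'} := by
  obtain ⟨e, hex, hex'⟩ := (D.isBranching_pair_iff hx).1 hb
  have hey := D.δ_eq_simple_mul hlen hex hxy
  have hey' := D.δ_eq_simple_mul hlen hex' hxy'
  have hlen' : ¬ cs.IsRightDescent w t := by
    rwa [CoxeterSystem.IsRightDescent, ← hw]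
  obtain ⟨z, hez, hzy⟩ := D.exists_δ_eq_of_δ_eq_mul_simple hlen' (hey.trans hw)
  -- The distances from `e` to `z` and to `y'` are `w` and `sw`, of different lengths.
  have hzy' : z ≠ y' := by
    rintro rfl
    have h := congrArg cs.length (hey'.symm.trans hez)
    exact cs.length_simple_mul_ne w s h
  refine (D.isBranching_pair_iff hy).2 ⟨z, hzy, D.δ_eq_simple_iff.2 ⟨?_, hzy'⟩⟩
  exact (D.adj t).trans (D.δ_eq_simple_iff.1 hzy).1 (D.δ_eq_simple_iff.1 hy).1

end Building

theorem lemma3p5 {S W Δ : Type*} [Group W] {M : CoxeterMatrix S} (cs : CoxeterSystem M W)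
    (D : Building cs Δ) (A : Set Δ) (hA : D.IsApartment A)
    (Ω : Set (Set Δ)) (hΩ : D.IsWallIn A Ω)
    (hbranch : ∃ P ∈ Ω, D.IsBranching P) :
    ∀ P ∈ Ω, D.IsBranching P := by
  obtain ⟨r, hr, α, hα, -, rfl⟩ := hΩ
  obtain ⟨_, ⟨P, hP, rfl⟩, hb⟩ := hbranch
  rintro _ ⟨Q, hQ, rfl⟩
  obtain ⟨d, t, hd, hQeq⟩ := cs.exists_simple_of_mem_wall hr hQ
  have hdQ : d ∈ ⋃₀ cs.wall r := ⟨Q, hQ, by simp [hQeq]⟩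
  have hdQ' : d * cs.simple t ∈ ⋃₀ cs.wall r := ⟨Q, hQ, by simp [hQeq]⟩
  -- Kept general in `c` so that `P` can be read from either of its two chambers.
  have key : ∀ (c : W) (s : S), r * c = c * cs.simple s → P = {c, c * cs.simple s} →
      ¬ cs.IsLeftDescent (c⁻¹ * d) s → D.IsBranching (α '' Q) := by
    intro c s hc hPeq hlen
    have hcP : c ∈ ⋃₀ cs.wall r := ⟨P, hP, by simp [hPeq]⟩
    have hcP' : c * cs.simple s ∈ ⋃₀ cs.wall r := ⟨P, hP, by simp [hPeq]⟩
    have hs : cs.simple s = c⁻¹ * r * c := by rw [mul_assoc, hc]; group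
    have ht : cs.simple t = d⁻¹ * r * d := by rw [mul_assoc, hd]; group
    have hw : cs.simple s * (c⁻¹ * d) = c⁻¹ * d * cs.simple t := by rw [hs, ht]; group
    simp only [hPeq, Set.image_pair] at hb
    rw [hQeq, Set.image_pair]
    refine Building.IsBranching.of_parallel D hw hlen
      ((hα c hcP _ hcP').trans (inv_mul_cancel_left _ _))
      ((hα d hdQ _ hdQ').trans (inv_mul_cancel_left _ _)) (hα c hcP d hdQ)
      ((hα _ hcP' _ hdQ').trans ?_) hb
    change (c * cs.simple s)⁻¹ * (d * cs.simple t) = c⁻¹ * d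
    -- With `w = c⁻¹ d`, the distance is `s(wt) = s(sw) = w`.
    rw [mul_inv_rev, mul_assoc, ← mul_assoc c⁻¹, ← hw, inv_mul_cancel_left]
  obtain ⟨c, s, hc, hPeq⟩ := cs.exists_simple_of_mem_wall hr hP
  by_cases hlen : cs.IsLeftDescent (c⁻¹ * d) s
  -- Starting from `cs` turns `w` into `sw`, of which `s` is no longer a left descent.
  · refine key (c * cs.simple s) s (by rw [← mul_assoc, hc]) ?_ ?_
    · rw [hPeq, Set.pair_comm, mul_assoc, cs.simple_mul_simple_self, mul_one]
    · rw [mul_inv_rev, cs.inv_simple, mul_assoc]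
      exact cs.isLeftDescent_iff_not_isLeftDescent_mul.1 hlen
  · exact key c s hc hPeq hlen
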